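/- Let $\mu,\tau>0$, and let $\{\alpha_k\}_{k\ge1}$ and $\{\delta_k\}_{k\ge1}$ be sequences of real random variables on a common probability space such that all the variables $\alpha_1,\delta_1,\alpha_2,\delta_2,\dots$ are mutually independent, each $\alpha_k$ is exponentially distributed with rate $\mu$ (mean $1/\mu$), and each $\delta_k$ is exponentially distributed with rate $\tau$ (mean $1/\tau$). Consider the system $\boldsymbol z(k)=A(k)\boldsymbol z(k-1)$, $k\ge 1$, where $$ A(k)=\begin{pmatrix}\alpha_k & 0\\ 0 & \delta_k\end{pmatrix},\qquad \boldsymbol z(k)=\begin{pmatrix}x(k)\\ y(k)\end{pmatrix},\qquad \boldsymbol z(0)=\begin{pmatrix}0\\ 0\end{pmatrix}, $$ and the matrix-vector product is taken in the max-plus semiring (maximum as addition, ordinary addition as multiplication; the entries $0$ are the real number $0$); that is, $$ x(k)=\max(x(k-1)+\alpha_k,\;y(k-1)),\qquad y(k)=\max(x(k-1),\;y(k-1)+\delta_k). $$ Then the Lyapunov exponent $\lambda=\lim_{k\to\infty}\frac1k\max(x(k),y(k))$ exists almost surely and almost surely equals the constant $$ \lambda=\frac{\mu^{4}+\mu^{3}\tau+\mu^{2}\tau^{2}+\mu\tau^{3}+\tau^{4}}{\mu\tau(\mu+\tau)(\mu^{2}+\tau^{2})}.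 $$ In particular, for $\mu=\tau=1$ one has $\lambda=1.25$. -/

import Mathlib

open MeasureTheory ProbabilityTheory Filter Topology

namespace MaxPlus

noncomputable section

/-- Product of a `2 × 2` matrix and a vector in the semiring with maximum as addition and `+` as
multiplication. -/
def mulVec (A : Matrix (Fin 2) (Fin 2) ℝ) (z : Fin 2 → ℝ) : Fin 2 → ℝ :=
  fun i => max (z 0 + A i 0) (z 1 + A i 1)

/-- State vectors of `z(k) = A(k) z(k-1)`, `z(0) = (0, 0)`.  The term `A k` of the sequence is the
transition matrix of step `k + 1`, i.e. the transition matrices are numbered from `0`. -/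
def state (A : ℕ → Matrix (Fin 2) (Fin 2) ℝ) : ℕ → Fin 2 → ℝ
  | 0 => fun _ => 0
  | k + 1 => mulVec (A k) (state A k)

/-- `l` is the Lyapunov exponent of the stochastic system with random transition matrices `A k`:
almost surely, `max (x(k), y(k)) / k` converges to `l`. -/
def IsLyapunovExponent {Ω : Type*} [MeasurableSpace Ω] (P : Measure Ω)
    (A : ℕ → Ω → Matrix (Fin 2) (Fin 2) ℝ) (l : ℝ) : Prop :=
  ∀ᵐ ω ∂P, Tendsto
    (fun k : ℕ => 1 / (k : ℝ) *
      max (state (fun n => A n ω) k 0) (state (fun n => A n ω) k 1))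
    atTop (𝓝 l)

end

end MaxPlus

/-! The proof finds a function `h = potential` of the state whose mean rises by exactly `l` at each
step. Suppose `x ≥ y` and put `D = x - y`. Since `α > 0`, the next state is `x + (α, (δ - D)⁺)`. By
lack of memory, `(δ - D)⁺` is `0` with probability `1 - exp (-τD)` and otherwise a fresh exponential
variable of rate `τ`. The mean of `h` after the step is therefore `x` plus a combination of `E h(α,
0)` and `E h(α, δ)` with these weights. Hence a correction `Q (1 - exp (-τD))` suffices when `x`
leads, and symmetrically `S (1 - exp (-μD))` with `D = y - x` when `y` leads. The identity `E
h(next) = h + l` reduces to three linear equations in `Q`, `S`, `l` (`integral_potential_step`).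

Consequently `h(z(n)) - l n` is a martingale. Its increments are dominated by `|α| + |δ|` plus a
constant, so its second moment is `O(n)` (`second_moment_compensated_potential_le`). Summing second
moments along `n²` gives almost sure convergence there. Boundedness of `h - max` transfers this to
the maximum, and monotonicity of the maximum fills the gaps between squares. -/

namespace MaxPlus

/-! ### Integrals against the exponential distribution -/

lemma expMeasure_eq_withDensity (r : ℝ) :
    expMeasure r = (volume.restrict (Set.Ioi 0)).withDensity
      (fun t => ENNReal.ofReal (r * Real.exp (-(r * t)))) := by
  have h : expMeasure r = volume.withDensity (exponentialPDF r) := rfl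
  have h' : exponentialPDF r = (Set.Ici (0 : ℝ)).indicator
      (fun t => ENNReal.ofReal (r * Real.exp (-(r * t)))) := by
    ext t
    by_cases ht : 0 ≤ t
    · rw [Set.indicator_of_mem (Set.mem_Ici.2 ht), exponentialPDF_of_nonneg ht]
    · rw [Set.indicator_of_notMem (by simpa using ht), exponentialPDF_of_neg (not_le.1 ht)]
  rw [h, h', withDensity_indicator measurableSet_Ici,
    Measure.restrict_congr_set Ioi_ae_eq_Ici]

lemma integral_expMeasure {r : ℝ} (hr : 0 < r) (f : ℝ → ℝ) :
    ∫ t, f t ∂expMeasure r = ∫ t in Set.Ioi 0, r * Real.exp (-(r * t)) * f t := by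
  rw [expMeasure_eq_withDensity, integral_withDensity_eq_integral_toReal_smul (by fun_prop)
    (ae_of_all _ fun _ => ENNReal.ofReal_lt_top)]
  refine integral_congr_ae (ae_of_all _ fun t => ?_)
  simp only [smul_eq_mul]
  rw [ENNReal.toReal_ofReal (by positivity)]

lemma ae_expMeasure_pos (r : ℝ) : ∀ᵐ t ∂expMeasure r, 0 < t := by
  rw [expMeasure_eq_withDensity]
  exact (withDensity_absolutelyContinuous _ _).ae_le (ae_restrict_mem measurableSet_Ioi)

lemma integral_exp_expMeasure {r a : ℝ} (hr : 0 < r) (ha : 0 < a) :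
    ∫ t, Real.exp (-(a * t)) ∂expMeasure r = r / (r + a) := by
  rw [integral_expMeasure hr]
  have h : ∀ t : ℝ, r * Real.exp (-(r * t)) * Real.exp (-(a * t))
      = r * Real.exp (-(r + a) * t) := by
    intro t
    rw [mul_assoc, ← Real.exp_add]
    ring_nf
  simp_rw [h]
  rw [integral_const_mul, integral_exp_mul_Ioi (by linarith)]
  rw [neg_mul, mul_zero, neg_zero, Real.exp_zero, neg_div_neg_eq, mul_one_div]

lemma integral_id_expMeasure {r : ℝ} (hr : 0 < r) : ∫ t, t ∂expMeasure r = 1 / r := by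
  rw [integral_expMeasure hr]
  have h := Real.integral_rpow_mul_exp_neg_mul_Ioi (a := 2) two_pos hr
  rw [Real.Gamma_two] at h
  calc ∫ t in Set.Ioi (0 : ℝ), r * Real.exp (-(r * t)) * t
      = r * ∫ t in Set.Ioi (0 : ℝ), t ^ ((2 : ℝ) - 1) * Real.exp (-(r * t)) := by
        rw [← integral_const_mul]
        refine integral_congr_ae (ae_of_all _ fun t => ?_)
        norm_num
        ring
    _ = 1 / r := by
        rw [h]
        norm_num
        field_simp

lemma memLp_two_id_expMeasure {r : ℝ} (hr : 0 < r) : MemLp (fun t : ℝ => t) 2 (expMeasure r) := by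
  rw [memLp_two_iff_integrable_sq (by fun_prop), expMeasure_eq_withDensity,
    integrable_withDensity_iff_integrable_smul' (by fun_prop)
      (ae_of_all _ fun _ => ENNReal.ofReal_lt_top)]
  have h := (integrableOn_rpow_mul_exp_neg_mul_rpow (p := 1) (s := 2) (by norm_num)
    zero_lt_one hr).const_mul r
  refine h.congr (ae_of_all _ fun t => ?_)
  simp only [smul_eq_mul]
  rw [ENNReal.toReal_ofReal (by positivity)]
  norm_num
  ring

/-- The lack of memory of the exponential distribution. -/
lemma integral_excess_expMeasure {r : ℝ} (hr : 0 < r) {f : ℝ → ℝ} (hf : f 0 = 0) {d : ℝ}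
    (hd : 0 ≤ d) :
    ∫ t, f (max (t - d) 0) ∂expMeasure r = Real.exp (-(r * d)) * ∫ t, f t ∂expMeasure r := by
  rw [integral_expMeasure hr, integral_expMeasure hr, ← integral_const_mul,
    setIntegral_eq_of_subset_of_forall_sdiff_eq_zero (s := Set.Ioi d) measurableSet_Ioi
      (Set.Ioi_subset_Ioi hd)]
  -- Beyond `d`, translation by `d` turns the density into `exp (-(r * d))` times itself; below `d`
  -- the integrand is `f 0 = 0`.
  · have h := (measurePreserving_sub_right volume d).setIntegral_preimage_emb
      (MeasurableEquiv.subRight d).measurableEmbedding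
      (fun t => Real.exp (-(r * d)) * (r * Real.exp (-(r * t)) * f t)) (Set.Ioi 0)
    rw [← h]
    have hs : (fun x : ℝ => x - d) ⁻¹' Set.Ioi 0 = Set.Ioi d := by
      ext x; simp
    rw [hs]
    refine setIntegral_congr_fun measurableSet_Ioi fun t ht => ?_
    have ht' : d < t := ht
    rw [max_eq_left (by linarith)]
    have : Real.exp (-(r * t)) = Real.exp (-(r * d)) * Real.exp (-(r * (t - d))) := by
      rw [← Real.exp_add]; ring_nf
    rw [this]; ring
  · intro t ht
    have : t ≤ d := by simpa using ht.2
    rw [max_eq_right (by linarith), hf, mul_zero]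

/-- Square integrability of functions of linear growth of two independent exponential variables. -/
lemma memLp_two_of_linear_growth {μ τ : ℝ} (hμ : 0 < μ) (hτ : 0 < τ) {F : ℝ × ℝ → ℝ}
    (hF : Measurable F) (K : ℝ) (hK : ∀ w, |F w| ≤ |w.1| + |w.2| + K) :
    MemLp F 2 ((expMeasure μ).prod (expMeasure τ)) := by
  have := isProbabilityMeasure_expMeasure hμ
  have := isProbabilityMeasure_expMeasure hτ
  have h1 : MemLp (fun w : ℝ × ℝ => |w.1|) 2 ((expMeasure μ).prod (expMeasure τ)) :=
    ((memLp_two_id_expMeasure hμ).comp_measurePreserving measurePreserving_fst).abs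
  have h2 : MemLp (fun w : ℝ × ℝ => |w.2|) 2 ((expMeasure μ).prod (expMeasure τ)) :=
    ((memLp_two_id_expMeasure hτ).comp_measurePreserving measurePreserving_snd).abs
  refine ((h1.add h2).add (memLp_const K)).mono hF.aestronglyMeasurable (ae_of_all _ fun w => ?_)
  exact (hK w).trans (le_abs_self _)

lemma integrable_of_linear_growth {μ τ : ℝ} (hμ : 0 < μ) (hτ : 0 < τ) {F : ℝ × ℝ → ℝ}
    (hF : Measurable F) (K : ℝ) (hK : ∀ w, |F w| ≤ |w.1| + |w.2| + K) :
    Integrable F ((expMeasure μ).prod (expMeasure τ)) := by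
  have := isProbabilityMeasure_expMeasure hμ
  have := isProbabilityMeasure_expMeasure hτ
  exact (memLp_two_of_linear_growth hμ hτ hF K hK).integrable one_le_two

/-- The excess of an exponential variable over an independent exponential one. -/
lemma integral_excess_prod {μ τ : ℝ} (hμ : 0 < μ) (hτ : 0 < τ) {f : ℝ → ℝ} (hf : f 0 = 0)
    (hint : Integrable (fun w : ℝ × ℝ => f (max (w.2 - w.1) 0))
      ((expMeasure μ).prod (expMeasure τ))) :
    ∫ w : ℝ × ℝ, f (max (w.2 - w.1) 0) ∂((expMeasure μ).prod (expMeasure τ))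
      = μ / (μ + τ) * ∫ t, f t ∂expMeasure τ := by
  have := isProbabilityMeasure_expMeasure hμ
  have := isProbabilityMeasure_expMeasure hτ
  rw [integral_prod _ hint, ← integral_exp_expMeasure hμ hτ, ← integral_mul_const]
  refine integral_congr_ae ?_
  filter_upwards [ae_expMeasure_pos μ] with a ha
  exact integral_excess_expMeasure hτ hf ha.le

lemma integral_prod_expMeasure_swap {μ τ : ℝ} (hμ : 0 < μ) (hτ : 0 < τ) (F : ℝ × ℝ → ℝ) :
    ∫ w, F w.swap ∂((expMeasure μ).prod (expMeasure τ))
      = ∫ w, F w ∂((expMeasure τ).prod (expMeasure μ)) := by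
  have := isProbabilityMeasure_expMeasure hμ
  have := isProbabilityMeasure_expMeasure hτ
  exact integral_prod_swap F

/-! ### The corrected maximum -/

/-- The maximum of the two coordinates, corrected by a bounded function of their difference. -/
noncomputable def potential (μ τ Q S x y : ℝ) : ℝ :=
  max x y + Q * (1 - Real.exp (-(τ * max (x - y) 0))) + S * (1 - Real.exp (-(μ * max (y - x) 0)))

/-- This symmetry reduces the one-step computation to states with `y ≤ x`. -/
lemma potential_swap (μ τ Q S x y : ℝ) : potential τ μ S Q y x = potential μ τ Q S x y := by
  unfold potential
  rw [max_comm y x]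
  ring

lemma potential_add (μ τ Q S c u v : ℝ) :
    potential μ τ Q S (c + u) (c + v) = c + potential μ τ Q S u v := by
  unfold potential
  rw [max_add_add_left, add_sub_add_left_eq_sub, add_sub_add_left_eq_sub]
  ring

lemma abs_one_sub_exp_le {r : ℝ} (hr : 0 < r) (t : ℝ) :
    |1 - Real.exp (-(r * max t 0))| ≤ 1 := by
  have h1 := Real.exp_pos (-(r * max t 0))
  have h2 : Real.exp (-(r * max t 0)) ≤ 1 :=
    Real.exp_le_one_iff.2 (neg_nonpos.2 (mul_nonneg hr.le (le_max_right _ _)))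
  rw [abs_le]
  constructor <;> linarith

lemma abs_potential_sub_max_le {μ τ : ℝ} (hμ : 0 < μ) (hτ : 0 < τ) (Q S x y : ℝ) :
    |potential μ τ Q S x y - max x y| ≤ |Q| + |S| := by
  have h : potential μ τ Q S x y - max x y = Q * (1 - Real.exp (-(τ * max (x - y) 0)))
      + S * (1 - Real.exp (-(μ * max (y - x) 0))) := by
    unfold potential; ring
  rw [h]
  refine (abs_add_le _ _).trans (add_le_add ?_ ?_) <;> rw [abs_mul]
  · exact mul_le_of_le_one_right (abs_nonneg _) (abs_one_sub_exp_le hτ _)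
  · exact mul_le_of_le_one_right (abs_nonneg _) (abs_one_sub_exp_le hμ _)

lemma measurable_potential (μ τ Q S : ℝ) :
    Measurable (fun w : ℝ × ℝ => potential μ τ Q S w.1 w.2) := by
  unfold potential
  fun_prop

lemma abs_max_le_add_abs (a b : ℝ) : |max a b| ≤ |a| + |b| :=
  abs_max_le_max_abs_abs.trans (max_le (by linarith [abs_nonneg b]) (by linarith [abs_nonneg a]))

lemma abs_max_sub_le_add_abs (a b : ℝ) : |max (a - b) 0| ≤ |a| + |b| :=
  (abs_max_le_add_abs _ _).trans (by simpa using abs_sub a b)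

/-! ### Means of the potential under exponential noise -/

lemma integral_linear_add_one_sub_exp {r a : ℝ} (hr : 0 < r) (ha : 0 < a) (c Q : ℝ) :
    ∫ t, (c * t + Q * (1 - Real.exp (-(a * t)))) ∂expMeasure r = c / r + Q * (a / (r + a)) := by
  have := isProbabilityMeasure_expMeasure hr
  have hid : Integrable (fun t : ℝ => t) (expMeasure r) :=
    (memLp_two_id_expMeasure hr).integrable one_le_two
  -- A non-integrable function has integral `0` by convention, so a nonzero value yields
  -- integrability.
  have hne : ∫ t, Real.exp (-(a * t)) ∂expMeasure r ≠ 0 := by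
    rw [integral_exp_expMeasure hr ha]; positivity
  have hexp : Integrable (fun t : ℝ => Real.exp (-(a * t))) (expMeasure r) :=
    Integrable.of_integral_ne_zero hne
  have hsub : Integrable (fun t : ℝ => 1 - Real.exp (-(a * t))) (expMeasure r) :=
    (integrable_const 1).sub hexp
  rw [integral_add (hid.const_mul c) (hsub.const_mul Q),
    integral_const_mul, integral_const_mul, integral_sub (integrable_const 1) hexp,
    integral_exp_expMeasure hr ha, integral_id_expMeasure hr, integral_const, probReal_univ]
  simp only [smul_eq_mul]
  have : r + a ≠ 0 := by positivity
  field_simp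
  ring

lemma integral_potential_zero_right {μ τ : ℝ} (hμ : 0 < μ) (hτ : 0 < τ) (Q S : ℝ) :
    ∫ w : ℝ × ℝ, potential μ τ Q S w.1 0 ∂((expMeasure μ).prod (expMeasure τ))
      = 1 / μ + Q * (τ / (μ + τ)) := by
  have := isProbabilityMeasure_expMeasure hμ
  have := isProbabilityMeasure_expMeasure hτ
  rw [integral_fun_fst (fun a => potential μ τ Q S a 0), probReal_univ, one_smul,
    ← integral_linear_add_one_sub_exp hμ hτ 1 Q]
  refine integral_congr_ae ?_
  filter_upwards [ae_expMeasure_pos μ] with a ha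
  unfold potential
  rw [max_eq_left ha.le, sub_zero, max_eq_left ha.le, zero_sub, max_eq_right (by linarith)]
  simp

lemma integral_potential {μ τ : ℝ} (hμ : 0 < μ) (hτ : 0 < τ) (Q S : ℝ) :
    ∫ w : ℝ × ℝ, potential μ τ Q S w.1 w.2 ∂((expMeasure μ).prod (expMeasure τ))
      = 1 / μ + 1 / τ - 1 / (μ + τ) + Q * (τ / (μ + τ)) ^ 2 + S * (μ / (μ + τ)) ^ 2 := by
  have := isProbabilityMeasure_expMeasure hμ
  have := isProbabilityMeasure_expMeasure hτ
  have hsnd : Integrable (fun w : ℝ × ℝ => w.2) ((expMeasure μ).prod (expMeasure τ)) :=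
    integrable_of_linear_growth hμ hτ (by fun_prop) 0
      (fun w => by linarith [abs_nonneg w.1])
  have hgrowth : ∀ {r s : ℝ}, 0 < r → 0 < s → ∀ {a : ℝ}, 0 < a → ∀ c R : ℝ, |c| ≤ 1 →
      Integrable (fun w : ℝ × ℝ => c * max (w.2 - w.1) 0
        + R * (1 - Real.exp (-(a * max (w.2 - w.1) 0)))) ((expMeasure r).prod (expMeasure s)) := by
    intro r s hr hs a ha c R hc
    refine integrable_of_linear_growth hr hs (by fun_prop) |R| fun w => ?_
    refine (abs_add_le _ _).trans (add_le_add ?_ ?_) <;> rw [abs_mul]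
    · refine (mul_le_of_le_one_left (abs_nonneg _) hc).trans ?_
      rw [add_comm]
      exact abs_max_sub_le_add_abs _ _
    · exact mul_le_of_le_one_right (abs_nonneg _) (abs_one_sub_exp_le ha _)
  -- Writing `max x y = y + (x - y)⁺` puts the linear term in the first excess only: coefficient `1`
  -- there and `0` in the second.
  have hfst := hgrowth hτ hμ hτ 1 Q (by simp)
  have hfst' : Integrable (fun w : ℝ × ℝ => 1 * max (w.1 - w.2) 0
        + Q * (1 - Real.exp (-(τ * max (w.1 - w.2) 0)))) ((expMeasure μ).prod (expMeasure τ)) :=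
    hfst.swap
  have hexc := hgrowth hμ hτ hμ 0 S (by simp)
  have e1 := integral_excess_prod hτ hμ
    (f := fun t => 1 * t + Q * (1 - Real.exp (-(τ * t)))) (by simp) hfst
  have e2 := integral_excess_prod hμ hτ
    (f := fun t => 0 * t + S * (1 - Real.exp (-(μ * t)))) (by simp) hexc
  rw [integral_linear_add_one_sub_exp hμ hτ, ← integral_prod_expMeasure_swap hμ hτ] at e1
  rw [integral_linear_add_one_sub_exp hτ hμ] at e2
  simp only [Prod.fst_swap, Prod.snd_swap] at e1
  have e0 : ∫ w : ℝ × ℝ, w.2 ∂((expMeasure μ).prod (expMeasure τ)) = 1 / τ := by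
    rw [integral_fun_snd (fun t => t), probReal_univ, one_smul, integral_id_expMeasure hτ]
  have hsplit : ∀ w : ℝ × ℝ, potential μ τ Q S w.1 w.2 = w.2
      + (1 * max (w.1 - w.2) 0 + Q * (1 - Real.exp (-(τ * max (w.1 - w.2) 0))))
      + (0 * max (w.2 - w.1) 0 + S * (1 - Real.exp (-(μ * max (w.2 - w.1) 0)))) := by
    intro w
    have : max w.1 w.2 = w.2 + max (w.1 - w.2) 0 := by rw [← max_add_add_left]; simp
    unfold potential
    rw [this]
    ring
  simp_rw [hsplit]
  rw [integral_add (hsnd.fun_add hfst') hexc, integral_add hsnd hfst', e0, e1, e2]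
  have : μ + τ ≠ 0 := by positivity
  have : τ + μ ≠ 0 := by positivity
  rw [add_comm τ μ]
  field_simp
  ring

lemma abs_potential_le {μ τ : ℝ} (hμ : 0 < μ) (hτ : 0 < τ) (Q S x y : ℝ) :
    |potential μ τ Q S x y| ≤ |x| + |y| + (|Q| + |S|) := by
  have h := abs_add_le (max x y) (potential μ τ Q S x y - max x y)
  rw [add_sub_cancel] at h
  exact h.trans (add_le_add (abs_max_le_add_abs _ _) (abs_potential_sub_max_le hμ hτ Q S x y))

lemma integrable_potential_excess {μ τ : ℝ} (hμ : 0 < μ) (hτ : 0 < τ) (Q S D : ℝ) :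
    Integrable (fun w : ℝ × ℝ => potential μ τ Q S w.1 (max (w.2 - D) 0))
      ((expMeasure μ).prod (expMeasure τ)) := by
  refine integrable_of_linear_growth hμ hτ ?_ (|D| + (|Q| + |S|)) fun w => ?_
  · exact (measurable_potential μ τ Q S).comp (by fun_prop : Measurable
      (fun w : ℝ × ℝ => (w.1, max (w.2 - D) 0)))
  · have := abs_potential_le hμ hτ Q S w.1 (max (w.2 - D) 0)
    have := abs_max_sub_le_add_abs w.2 D
    linarith

lemma integral_potential_excess {μ τ : ℝ} (hμ : 0 < μ) (hτ : 0 < τ) (Q S : ℝ) {D : ℝ}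
    (hD : 0 ≤ D) :
    ∫ w : ℝ × ℝ, potential μ τ Q S w.1 (max (w.2 - D) 0) ∂((expMeasure μ).prod (expMeasure τ))
      = (1 - Real.exp (-(τ * D))) * (1 / μ + Q * (τ / (μ + τ))) + Real.exp (-(τ * D)) *
        (1 / μ + 1 / τ - 1 / (μ + τ) + Q * (τ / (μ + τ)) ^ 2 + S * (μ / (μ + τ)) ^ 2) := by
  have := isProbabilityMeasure_expMeasure hμ
  have := isProbabilityMeasure_expMeasure hτ
  have i1 := integrable_potential_excess hμ hτ Q S D
  have i2 : Integrable (fun w : ℝ × ℝ => potential μ τ Q S w.1 w.2)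
      ((expMeasure μ).prod (expMeasure τ)) :=
    integrable_of_linear_growth hμ hτ (measurable_potential μ τ Q S) _
      (fun w => abs_potential_le hμ hτ Q S w.1 w.2)
  have i3 : Integrable (fun w : ℝ × ℝ => potential μ τ Q S w.1 0)
      ((expMeasure μ).prod (expMeasure τ)) := by
    refine integrable_of_linear_growth hμ hτ ?_ (|Q| + |S|) fun w => ?_
    · exact (measurable_potential μ τ Q S).comp (by fun_prop : Measurable
        (fun w : ℝ × ℝ => (w.1, (0 : ℝ))))
    · have := abs_potential_le hμ hτ Q S w.1 0
      rw [abs_zero] at this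
      linarith [abs_nonneg w.2]
  -- Lack of memory needs a function vanishing at `0`, so the value at second coordinate `0` is
  -- subtracted; Fubini applies it for each fixed first coordinate.
  have key : ∫ w : ℝ × ℝ, (potential μ τ Q S w.1 (max (w.2 - D) 0) - potential μ τ Q S w.1 0)
        ∂((expMeasure μ).prod (expMeasure τ))
      = Real.exp (-(τ * D)) * ∫ w : ℝ × ℝ, (potential μ τ Q S w.1 w.2 - potential μ τ Q S w.1 0)
        ∂((expMeasure μ).prod (expMeasure τ)) := by
    have e1 := integral_prod _ (i1.sub i3)
    have e2 := integral_prod _ (i2.sub i3)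
    simp only [Pi.sub_apply] at e1 e2
    rw [e1, e2, ← integral_const_mul]
    exact integral_congr_ae (ae_of_all _ fun a => integral_excess_expMeasure hτ
      (f := fun t => potential μ τ Q S a t - potential μ τ Q S a 0) (sub_self _) hD)
  rw [integral_sub i1 i3, integral_sub i2 i3, integral_potential hμ hτ,
    integral_potential_zero_right hμ hτ] at key
  linear_combination key

lemma ae_prod_expMeasure_pos {μ τ : ℝ} (hμ : 0 < μ) (hτ : 0 < τ) :
    ∀ᵐ w : ℝ × ℝ ∂((expMeasure μ).prod (expMeasure τ)), 0 < w.1 ∧ 0 < w.2 := by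
  have := isProbabilityMeasure_expMeasure hμ
  have := isProbabilityMeasure_expMeasure hτ
  exact (measurePreserving_fst.quasiMeasurePreserving.ae (ae_expMeasure_pos μ)).and
    (measurePreserving_snd.quasiMeasurePreserving.ae (ae_expMeasure_pos τ))

/-- `hQ` says that the mean of the potential at `(α, 0)` is `Q + l`, and `hl` that its mean at `(α,
δ)` is `l`. Weighted by `1 - exp (-τD)` and `exp (-τD)`, these add up to `l + Q (1 - exp (-τD))`. -/
lemma integral_potential_step_of_le {μ τ : ℝ} (hμ : 0 < μ) (hτ : 0 < τ) {Q S l : ℝ}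
    (hQ : 1 / μ + Q * (τ / (μ + τ)) = Q + l)
    (hl : 1 / μ + 1 / τ - 1 / (μ + τ) + Q * (τ / (μ + τ)) ^ 2 + S * (μ / (μ + τ)) ^ 2 = l)
    {x y : ℝ} (hxy : y ≤ x) :
    ∫ w : ℝ × ℝ, potential μ τ Q S (max (x + w.1) y) (max x (y + w.2))
      ∂((expMeasure μ).prod (expMeasure τ)) = potential μ τ Q S x y + l := by
  have := isProbabilityMeasure_expMeasure hμ
  have := isProbabilityMeasure_expMeasure hτ
  calc _ = ∫ w : ℝ × ℝ, (x + potential μ τ Q S w.1 (max (w.2 - (x - y)) 0))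
        ∂((expMeasure μ).prod (expMeasure τ)) := by
        refine integral_congr_ae ?_
        filter_upwards [ae_prod_expMeasure_pos hμ hτ] with w hw
        rw [max_eq_left (by linarith), ← potential_add, ← max_add_add_left, max_comm x]
        congr 2 <;> ring
    _ = x + ∫ w : ℝ × ℝ, potential μ τ Q S w.1 (max (w.2 - (x - y)) 0)
        ∂((expMeasure μ).prod (expMeasure τ)) := by
        rw [integral_add (integrable_const x) (integrable_potential_excess hμ hτ Q S (x - y)),
          integral_const, probReal_univ, one_smul]
    _ = _ := by
        rw [integral_potential_excess hμ hτ Q S (sub_nonneg.2 hxy), hl, hQ]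
        unfold potential
        rw [max_eq_left hxy, max_eq_left (sub_nonneg.2 hxy), max_eq_right (sub_nonpos.2 hxy),
          mul_zero, neg_zero, Real.exp_zero]
        ring

/-- One step of the system raises the mean of the potential by the constant `l`. -/
lemma integral_potential_step {μ τ : ℝ} (hμ : 0 < μ) (hτ : 0 < τ) {Q S l : ℝ}
    (hQ : 1 / μ + Q * (τ / (μ + τ)) = Q + l) (hS : 1 / τ + S * (μ / (μ + τ)) = S + l)
    (hl : 1 / μ + 1 / τ - 1 / (μ + τ) + Q * (τ / (μ + τ)) ^ 2 + S * (μ / (μ + τ)) ^ 2 = l)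
    (x y : ℝ) :
    ∫ w : ℝ × ℝ, potential μ τ Q S (max (x + w.1) y) (max x (y + w.2))
      ∂((expMeasure μ).prod (expMeasure τ)) = potential μ τ Q S x y + l := by
  rcases le_total y x with h | h
  · exact integral_potential_step_of_le hμ hτ hQ hl h
  · rw [← potential_swap, ← integral_potential_step_of_le hτ hμ (by rwa [add_comm τ μ])
      (by rw [add_comm τ μ]; linarith) h, ← integral_prod_expMeasure_swap hμ hτ]
    refine integral_congr_ae (ae_of_all _ fun w => ?_)
    simp only [Prod.fst_swap, Prod.snd_swap]
    rw [← potential_swap, max_comm x, max_comm y]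

/-! ### The state process -/

/-- The state `(x(n), y(n))` for the transition matrices with diagonals `(a k, d k)`. -/
noncomputable def coupled (a d : ℕ → ℝ) (n : ℕ) : ℝ × ℝ :=
  (state (fun k => !![a k, 0; 0, d k]) n 0, state (fun k => !![a k, 0; 0, d k]) n 1)

/-- One step of the system, from the state `z` and with the diagonal `w`. -/
noncomputable def step (z w : ℝ × ℝ) : ℝ × ℝ :=
  (max (z.1 + w.1) z.2, max z.1 (z.2 + w.2))

lemma coupled_zero (a d : ℕ → ℝ) : coupled a d 0 = (0, 0) := rfl

lemma coupled_succ (a d : ℕ → ℝ) (n : ℕ) :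
    coupled a d (n + 1) = step (coupled a d n) (a n, d n) := by
  simp [coupled, state, mulVec, step]

lemma measurable_step : Measurable (fun p : (ℝ × ℝ) × (ℝ × ℝ) => step p.1 p.2) := by
  unfold step
  fun_prop

lemma coupled_congr {a a' d d' : ℕ → ℝ} {n : ℕ} (ha : ∀ k < n, a k = a' k)
    (hd : ∀ k < n, d k = d' k) : coupled a d n = coupled a' d' n := by
  induction n with
  | zero => rfl
  | succ n ih =>
    rw [coupled_succ, coupled_succ, ih (fun k hk => ha k (by omega)) (fun k hk => hd k (by omega)),
      ha n (by omega), hd n (by omega)]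

lemma measurable_coupled {E : Type*} [MeasurableSpace E] {a d : ℕ → E → ℝ}
    (ha : ∀ k, Measurable (a k)) (hd : ∀ k, Measurable (d k)) (n : ℕ) :
    Measurable (fun t => coupled (fun k => a k t) (fun k => d k t) n) := by
  induction n with
  | zero => simp only [coupled_zero, measurable_const]
  | succ n ih =>
    simp_rw [coupled_succ]
    exact measurable_step.comp (ih.prodMk ((ha n).prodMk (hd n)))

lemma aemeasurable_coupled {E : Type*} [MeasurableSpace E] {P : Measure E} {a d : ℕ → E → ℝ}
    (ha : ∀ k, AEMeasurable (a k) P) (hd : ∀ k, AEMeasurable (d k) P) (n : ℕ) :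
    AEMeasurable (fun t => coupled (fun k => a k t) (fun k => d k t) n) P := by
  induction n with
  | zero => simp only [coupled_zero, aemeasurable_const]
  | succ n ih =>
    simp_rw [coupled_succ]
    exact measurable_step.comp_aemeasurable (ih.prodMk ((ha n).prodMk (hd n)))

lemma indepFun_coupled {Ω : Type*} [MeasurableSpace Ω] {P : Measure Ω} {α δ : ℕ → Ω → ℝ}
    (hα : ∀ k, AEMeasurable (α k) P) (hδ : ∀ k, AEMeasurable (δ k) P)
    (hindep : iIndepFun (fun i : ℕ ⊕ ℕ => Sum.elim α δ i) P) (n : ℕ) :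
    IndepFun (fun ω => coupled (fun k => α k ω) (fun k => δ k ω) n)
      (fun ω => (α n ω, δ n ω)) P := by
  set S : Finset (ℕ ⊕ ℕ) := (Finset.range n).disjSum (Finset.range n) with hS
  set T : Finset (ℕ ⊕ ℕ) := {Sum.inl n, Sum.inr n} with hT
  have hST : Disjoint S T := by
    rw [Finset.disjoint_left]
    rintro (k | k) h1 h2 <;> simp [hS, hT] at h1 h2 <;> omega
  have hmeas : ∀ i : ℕ ⊕ ℕ, AEMeasurable (Sum.elim α δ i) P := by
    rintro (k | k)
    · exact hα k
    · exact hδ k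
  have h := hindep.indepFun_finset₀ S T hST hmeas
  -- The default `0` is harmless: the state at time `n` reads only indices below `n`, by
  -- `coupled_congr`.
  let ext : (ℕ ⊕ ℕ) → (S → ℝ) → ℝ := fun i t => if h : i ∈ S then t ⟨i, h⟩ else 0
  have hext : ∀ i, Measurable (ext i) := by
    intro i
    by_cases hi : i ∈ S
    · simp only [ext, hi, dite_true]
      exact measurable_pi_apply _
    · simp only [ext, hi, dite_false]
      exact measurable_const
  have hG := measurable_coupled (fun k => hext (Sum.inl k)) (fun k => hext (Sum.inr k)) n
  have hH : Measurable (fun t : T → ℝ =>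
      (t ⟨Sum.inl n, by simp [hT]⟩, t ⟨Sum.inr n, by simp [hT]⟩)) :=
    (measurable_pi_apply _).prodMk (measurable_pi_apply _)
  have h' := h.comp hG hH
  refine h'.congr (ae_of_all _ fun ω => ?_) (ae_of_all _ fun ω => rfl)
  refine coupled_congr (fun k hk => ?_) (fun k hk => ?_)
  · have : Sum.inl k ∈ S := by simp [hS, hk]
    simp [ext, this]
  · have : Sum.inr k ∈ S := by simp [hS, hk]
    simp [ext, this]

/-- A centred increment depending on independent noise is orthogonal to functions of the past. -/
lemma integral_mul_centred_eq_zero {Ω E F : Type*} [MeasurableSpace Ω] [MeasurableSpace E]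
    [MeasurableSpace F] {P : Measure Ω} [IsProbabilityMeasure P] {X : Ω → E} {W : Ω → F}
    {ρ : Measure F} (hX : AEMeasurable X P) (hW : HasLaw W ρ P) (hXW : IndepFun X W P)
    {f : E → ℝ} {g : E × F → ℝ} (hf : Measurable f) (hg : Measurable g)
    (hint : Integrable (fun ω => f (X ω) * g (X ω, W ω)) P)
    (hzero : ∀ x, ∫ w, g (x, w) ∂ρ = 0) :
    ∫ ω, f (X ω) * g (X ω, W ω) ∂P = 0 := by
  have := hW.isProbabilityMeasure_iff.1 inferInstance
  have := Measure.isProbabilityMeasure_map hX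
  have hm : Measurable (fun p : E × F => f p.1 * g p) := (hf.comp measurable_fst).mul hg
  have hlaw := (indepFun_iff_map_prod_eq_prod_map_map hX hW.aemeasurable).1 hXW
  rw [hW.map_eq] at hlaw
  have hpair : AEMeasurable (fun ω => (X ω, W ω)) P := hX.prodMk hW.aemeasurable
  have hint' : Integrable (fun p : E × F => f p.1 * g p) ((P.map X).prod ρ) := by
    rw [← hlaw, integrable_map_measure hm.aestronglyMeasurable hpair]
    exact hint
  calc ∫ ω, f (X ω) * g (X ω, W ω) ∂P = ∫ p, f p.1 * g p ∂(P.map (fun ω => (X ω, W ω))) :=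
        (integral_map hpair hm.aestronglyMeasurable).symm
    _ = 0 := by
        rw [hlaw, integral_prod _ hint']
        simp only [integral_const_mul, hzero, mul_zero, integral_zero]

/-- A sequence whose second moments grow at most linearly is almost surely `o(n)` along squares. -/
lemma ae_tendsto_div_sq_of_second_moment_le {Ω : Type*} [MeasurableSpace Ω] {P : Measure Ω}
    {M : ℕ → Ω → ℝ} (hM : ∀ n, MemLp (M n) 2 P) {C : ℝ} (hC : ∀ n, ∫ ω, M n ω ^ 2 ∂P ≤ C * n) :
    ∀ᵐ ω ∂P, Tendsto (fun n : ℕ => M (n ^ 2) ω / (n : ℝ) ^ 2) atTop (𝓝 0) := by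
  -- Along squares the normalized second moments are at most `C / n²`, which is summable; hence the
  -- series of squares is almost surely finite and its terms tend to `0`.
  have hbound : ∀ n : ℕ, ∫⁻ ω, ENNReal.ofReal ((M (n ^ 2) ω / (n : ℝ) ^ 2) ^ 2) ∂P
      ≤ ENNReal.ofReal (C * (1 / (n : ℝ) ^ 2)) := by
    intro n
    have hi : Integrable (fun ω => (M (n ^ 2) ω / (n : ℝ) ^ 2) ^ 2) P := by
      simp_rw [div_pow]
      exact (hM (n ^ 2)).integrable_sq.div_const _
    rw [← ofReal_integral_eq_lintegral_ofReal hi (ae_of_all _ fun _ => sq_nonneg _)]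
    refine ENNReal.ofReal_le_ofReal ?_
    simp_rw [div_pow]
    rw [integral_div]
    rcases Nat.eq_zero_or_pos n with rfl | hn
    · simp
    · have hn' : (0 : ℝ) < n := Nat.cast_pos.2 hn
      rw [div_le_iff₀ (by positivity)]
      have h := hC (n ^ 2)
      push_cast at h
      refine h.trans (le_of_eq ?_)
      field_simp
  have hsum : ∫⁻ ω, ∑' n : ℕ, ENNReal.ofReal ((M (n ^ 2) ω / (n : ℝ) ^ 2) ^ 2) ∂P ≠ ⊤ := by
    rw [lintegral_tsum fun n =>
      (((hM (n ^ 2)).aestronglyMeasurable.aemeasurable.div_const _).pow_const 2).ennreal_ofReal]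
    have hs : Summable (fun n : ℕ => C * (1 / (n : ℝ) ^ 2)) :=
      (Real.summable_one_div_nat_pow.2 one_lt_two).mul_left C
    exact ne_top_of_le_ne_top hs.tsum_ofReal_ne_top (ENNReal.tsum_le_tsum hbound)
  have hmeas : AEMeasurable
      (fun ω => ∑' n : ℕ, ENNReal.ofReal ((M (n ^ 2) ω / (n : ℝ) ^ 2) ^ 2)) P :=
    AEMeasurable.tsum fun n =>
      (((hM (n ^ 2)).aestronglyMeasurable.aemeasurable.div_const _).pow_const 2).ennreal_ofReal
  filter_upwards [ae_lt_top' hmeas hsum] with ω hω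
  have h0 := ENNReal.tendsto_atTop_zero_of_tsum_ne_top hω.ne
  have h1 := (ENNReal.tendsto_toReal ENNReal.zero_ne_top).comp h0
  have h2 := (Real.continuous_sqrt.tendsto 0).comp h1
  rw [Real.sqrt_zero] at h2
  rw [tendsto_zero_iff_abs_tendsto_zero]
  refine h2.congr fun n => ?_
  simp only [Function.comp_apply]
  rw [ENNReal.toReal_ofReal (sq_nonneg _), Real.sqrt_sq_eq_abs]

lemma tendsto_div_of_monotone_of_tendsto_div_sq {u : ℕ → ℝ} {l : ℝ} (hu : Monotone u)
    (h : Tendsto (fun n : ℕ => u (n ^ 2) / (n : ℝ) ^ 2) atTop (𝓝 l)) :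
    Tendsto (fun n : ℕ => u n / n) atTop (𝓝 l) := by
  refine tendsto_div_of_monotone_of_exists_subseq_tendsto_div u l hu fun a ha =>
    ⟨fun n => n ^ 2, ?_, tendsto_pow_atTop two_ne_zero, by simpa using h⟩
  -- The threshold gives `(n + 1)² ≤ a n²`, since `2n + 1 ≤ 3n ≤ (a - 1) n²`.
  filter_upwards [eventually_ge_atTop 1, eventually_ge_atTop ⌈3 / (a - 1)⌉₊] with n h1 h2
  have h1' : (1 : ℝ) ≤ n := by exact_mod_cast h1
  have h2' : 3 / (a - 1) ≤ (n : ℝ) := (Nat.le_ceil _).trans (by exact_mod_cast h2)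
  rw [div_le_iff₀ (by linarith)] at h2'
  push_cast
  nlinarith

lemma le_max_step {z w : ℝ × ℝ} (h1 : 0 ≤ w.1) (h2 : 0 ≤ w.2) :
    max z.1 z.2 ≤ max (step z w).1 (step z w).2 := by
  unfold step
  simp only
  refine max_le (le_max_of_le_left (le_max_of_le_left ?_))
    (le_max_of_le_right (le_max_of_le_right ?_)) <;> linarith

/-- The bound is free of `z`, which makes the second moments of the increments uniform in time. -/
lemma abs_max_step_sub_max_le (z w : ℝ × ℝ) :
    |max (step z w).1 (step z w).2 - max z.1 z.2| ≤ |w.1| + |w.2| := by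
  have hx := le_max_left z.1 z.2
  have hy := le_max_right z.1 z.2
  have h1 := le_abs_self w.1
  have h2 := le_abs_self w.2
  have h3 := abs_nonneg w.1
  have h4 := abs_nonneg w.2
  unfold step
  rw [abs_le]
  constructor
  -- The off-diagonal zeros pass each coordinate unchanged to the other one.
  · have : max z.1 z.2 ≤ max (max (z.1 + w.1) z.2) (max z.1 (z.2 + w.2)) :=
      max_le (le_max_of_le_right (le_max_left _ _)) (le_max_of_le_left (le_max_right _ _))
    linarith
  · rw [sub_le_iff_le_add]
    refine max_le (max_le ?_ ?_) (max_le ?_ ?_) <;> linarith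

/-- The increment of the potential in one step, minus `l`. -/
noncomputable def increment (μ τ Q S l : ℝ) (p : (ℝ × ℝ) × (ℝ × ℝ)) : ℝ :=
  potential μ τ Q S (step p.1 p.2).1 (step p.1 p.2).2 - potential μ τ Q S p.1.1 p.1.2 - l

lemma measurable_increment (μ τ Q S l : ℝ) : Measurable (increment μ τ Q S l) :=
  (((measurable_potential μ τ Q S).comp measurable_step).sub
    ((measurable_potential μ τ Q S).comp measurable_fst)).sub_const l

lemma abs_increment_le {μ τ : ℝ} (hμ : 0 < μ) (hτ : 0 < τ) (Q S l : ℝ) (z w : ℝ × ℝ) :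
    |increment μ τ Q S l (z, w)| ≤ |w.1| + |w.2| + (2 * (|Q| + |S|) + |l|) := by
  have h1 := abs_le.1 (abs_max_step_sub_max_le z w)
  have h2 := abs_le.1 (abs_potential_sub_max_le hμ hτ Q S (step z w).1 (step z w).2)
  have h3 := abs_le.1 (abs_potential_sub_max_le hμ hτ Q S z.1 z.2)
  have h4 := abs_le.1 (le_refl |l|)
  unfold increment
  rw [abs_le]
  constructor <;> simp only <;> linarith

lemma integral_increment {μ τ : ℝ} (hμ : 0 < μ) (hτ : 0 < τ) {Q S l : ℝ}
    (hQ : 1 / μ + Q * (τ / (μ + τ)) = Q + l) (hS : 1 / τ + S * (μ / (μ + τ)) = S + l)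
    (hl : 1 / μ + 1 / τ - 1 / (μ + τ) + Q * (τ / (μ + τ)) ^ 2 + S * (μ / (μ + τ)) ^ 2 = l)
    (z : ℝ × ℝ) :
    ∫ w, increment μ τ Q S l (z, w) ∂((expMeasure μ).prod (expMeasure τ)) = 0 := by
  have := isProbabilityMeasure_expMeasure hμ
  have := isProbabilityMeasure_expMeasure hτ
  have hi : Integrable (fun w => increment μ τ Q S l (z, w))
      ((expMeasure μ).prod (expMeasure τ)) :=
    integrable_of_linear_growth hμ hτ
      ((measurable_increment μ τ Q S l).comp measurable_prodMk_left) _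
      (abs_increment_le hμ hτ Q S l z)
  have h := integral_potential_step hμ hτ hQ hS hl z.1 z.2
  have e : ∀ w : ℝ × ℝ, potential μ τ Q S (max (z.1 + w.1) z.2) (max z.1 (z.2 + w.2))
      = increment μ τ Q S l (z, w) + (potential μ τ Q S z.1 z.2 + l) := by
    intro w
    simp only [increment, step]
    ring
  simp_rw [e] at h
  rw [integral_add hi (integrable_const _), integral_const, probReal_univ, one_smul] at h
  linarith

/-! ### Martingale estimate and growth rate -/

section Growth

variable {Ω : Type*} [MeasurableSpace Ω] {P : Measure Ω} [IsProbabilityMeasure P]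
  {μ τ : ℝ} {α δ : ℕ → Ω → ℝ}

lemma hasLaw_pair
    (hα : ∀ k, HasLaw (α k) (expMeasure μ) P) (hδ : ∀ k, HasLaw (δ k) (expMeasure τ) P)
    (hindep : iIndepFun (fun i : ℕ ⊕ ℕ => Sum.elim α δ i) P) (n : ℕ) :
    HasLaw (fun ω => (α n ω, δ n ω)) ((expMeasure μ).prod (expMeasure τ)) P := by
  have h : IndepFun (α n) (δ n) P := hindep.indepFun (i := Sum.inl n) (j := Sum.inr n) (by simp)
  refine ⟨(hα n).aemeasurable.prodMk (hδ n).aemeasurable, ?_⟩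
  rw [(indepFun_iff_map_prod_eq_prod_map_map (hα n).aemeasurable (hδ n).aemeasurable).1 h,
    (hα n).map_eq, (hδ n).map_eq]

/-- The compensated potential is square integrable, with at most linearly growing second moments. -/
lemma second_moment_compensated_potential_le (hμ : 0 < μ) (hτ : 0 < τ)
    (hα : ∀ k, HasLaw (α k) (expMeasure μ) P) (hδ : ∀ k, HasLaw (δ k) (expMeasure τ) P)
    (hindep : iIndepFun (fun i : ℕ ⊕ ℕ => Sum.elim α δ i) P) {Q S l : ℝ}
    (hQ : 1 / μ + Q * (τ / (μ + τ)) = Q + l) (hS : 1 / τ + S * (μ / (μ + τ)) = S + l)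
    (hl : 1 / μ + 1 / τ - 1 / (μ + τ) + Q * (τ / (μ + τ)) ^ 2 + S * (μ / (μ + τ)) ^ 2 = l) :
    ∃ C : ℝ, ∀ n : ℕ,
      MemLp (fun ω => potential μ τ Q S (coupled (α · ω) (δ · ω) n).1
        (coupled (α · ω) (δ · ω) n).2 - l * n) 2 P ∧
      ∫ ω, (potential μ τ Q S (coupled (α · ω) (δ · ω) n).1
        (coupled (α · ω) (δ · ω) n).2 - l * n) ^ 2 ∂P ≤ C * n := by
  set K : ℝ := 2 * (|Q| + |S|) + |l| with hK
  have hK0 : 0 ≤ K := by positivity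
  set ρ := (expMeasure μ).prod (expMeasure τ)
  set B : ℝ × ℝ → ℝ := fun w => |w.1| + |w.2| + K with hB
  have hBm : Measurable B := by fun_prop
  have hB0 : ∀ w, 0 ≤ B w := fun w => by positivity
  have hBL : MemLp B 2 ρ := memLp_two_of_linear_growth hμ hτ hBm K fun w =>
    (abs_of_nonneg (hB0 w)).le
  have hlaw : ∀ n, HasLaw (fun ω => (α n ω, δ n ω)) ρ P := hasLaw_pair hα hδ hindep
  have hZ : ∀ n, AEMeasurable (fun ω => coupled (α · ω) (δ · ω) n) P :=
    aemeasurable_coupled (fun k => (hα k).aemeasurable) (fun k => (hδ k).aemeasurable)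
  have hBn : ∀ n, MemLp (fun ω => B (α n ω, δ n ω)) 2 P := by
    intro n
    have h := hBL
    rw [← (hlaw n).map_eq, memLp_map_measure_iff hBm.aestronglyMeasurable
      (hlaw n).aemeasurable] at h
    exact h
  have hinc : ∀ n, MemLp (fun ω => increment μ τ Q S l
      (coupled (α · ω) (δ · ω) n, (α n ω, δ n ω))) 2 P := by
    intro n
    refine (hBn n).mono ((measurable_increment μ τ Q S l).comp_aemeasurable
      ((hZ n).prodMk (hlaw n).aemeasurable)).aestronglyMeasurable (ae_of_all _ fun ω => ?_)
    exact (abs_increment_le hμ hτ Q S l _ _).trans (le_abs_self _)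
  have hincC : ∀ n, ∫ ω, increment μ τ Q S l
      (coupled (α · ω) (δ · ω) n, (α n ω, δ n ω)) ^ 2 ∂P ≤ ∫ w, B w ^ 2 ∂ρ := by
    intro n
    rw [← (hlaw n).map_eq, integral_map (hlaw n).aemeasurable (by fun_prop)]
    refine integral_mono (hinc n).integrable_sq (hBn n).integrable_sq fun ω => ?_
    exact sq_le_sq' (abs_le.1 (abs_increment_le hμ hτ Q S l _ _)).1
      (abs_le.1 (abs_increment_le hμ hτ Q S l _ _)).2
  refine ⟨∫ w, B w ^ 2 ∂ρ, fun n => ?_⟩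
  induction n with
  | zero => simp [coupled_zero, potential]
  | succ n ih =>
    obtain ⟨ihL, ihC⟩ := ih
    have hrec : ∀ ω, potential μ τ Q S (coupled (α · ω) (δ · ω) (n + 1)).1
        (coupled (α · ω) (δ · ω) (n + 1)).2 - l * ((n + 1 : ℕ) : ℝ)
        = (potential μ τ Q S (coupled (α · ω) (δ · ω) n).1 (coupled (α · ω) (δ · ω) n).2 - l * n)
          + increment μ τ Q S l (coupled (α · ω) (δ · ω) n, (α n ω, δ n ω)) := by
      intro ω
      rw [coupled_succ]
      simp only [increment]
      push_cast
      ring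
    simp_rw [hrec]
    refine ⟨ihL.add (hinc n), ?_⟩
    have hcross := ihL.integrable_mul (hinc n)
    -- Orthogonality of martingale increments: the cross term vanishes, so each step adds at most `∫
    -- B²` to the second moment.
    have horth := integral_mul_centred_eq_zero (hZ n) (hlaw n)
      (indepFun_coupled (fun k => (hα k).aemeasurable) (fun k => (hδ k).aemeasurable) hindep n)
      (f := fun z => potential μ τ Q S z.1 z.2 - l * n) (g := increment μ τ Q S l)
      ((measurable_potential μ τ Q S).sub_const _) (measurable_increment μ τ Q S l) hcross
      (integral_increment hμ hτ hQ hS hl)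
    simp_rw [add_sq, mul_assoc (2 : ℝ)]
    have i1 := ihL.integrable_sq
    have i2 := (hinc n).integrable_sq
    have i3 : Integrable (fun ω => 2 * ((potential μ τ Q S (coupled (α · ω) (δ · ω) n).1
        (coupled (α · ω) (δ · ω) n).2 - l * n)
        * increment μ τ Q S l (coupled (α · ω) (δ · ω) n, (α n ω, δ n ω)))) P :=
      hcross.const_mul 2
    rw [integral_add (i1.fun_add i3) i2, integral_add i1 i3, integral_const_mul, horth]
    have := hincC n
    push_cast
    linarith

/-- The growth rate of the system, for a potential solving the balance equations. -/
lemma ae_tendsto_max_coupled_div (hμ : 0 < μ) (hτ : 0 < τ)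
    (hα : ∀ k, HasLaw (α k) (expMeasure μ) P) (hδ : ∀ k, HasLaw (δ k) (expMeasure τ) P)
    (hindep : iIndepFun (fun i : ℕ ⊕ ℕ => Sum.elim α δ i) P) {Q S l : ℝ}
    (hQ : 1 / μ + Q * (τ / (μ + τ)) = Q + l) (hS : 1 / τ + S * (μ / (μ + τ)) = S + l)
    (hl : 1 / μ + 1 / τ - 1 / (μ + τ) + Q * (τ / (μ + τ)) ^ 2 + S * (μ / (μ + τ)) ^ 2 = l) :
    ∀ᵐ ω ∂P, Tendsto (fun n : ℕ => max (coupled (α · ω) (δ · ω) n).1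
      (coupled (α · ω) (δ · ω) n).2 / (n : ℝ)) atTop (𝓝 l) := by
  obtain ⟨C, hC⟩ := second_moment_compensated_potential_le hμ hτ hα hδ hindep hQ hS hl
  have hpos : ∀ᵐ ω ∂P, ∀ k, 0 < α k ω ∧ 0 < δ k ω := by
    rw [ae_all_iff]
    intro k
    have h := ae_prod_expMeasure_pos hμ hτ
    rw [← (hasLaw_pair hα hδ hindep k).map_eq] at h
    exact ae_of_ae_map (hasLaw_pair hα hδ hindep k).aemeasurable h
  filter_upwards [hpos, ae_tendsto_div_sq_of_second_moment_le (fun n => (hC n).1)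
    (fun n => (hC n).2)] with ω hω hlim
  refine tendsto_div_of_monotone_of_tendsto_div_sq (u := fun n =>
    max (coupled (α · ω) (δ · ω) n).1 (coupled (α · ω) (δ · ω) n).2)
    (monotone_nat_of_le_succ fun n => ?_) ?_
  · rw [coupled_succ]
    exact le_max_step (hω n).1.le (hω n).2.le
  have hsq : Tendsto (fun n : ℕ => (n : ℝ) ^ 2) atTop atTop :=
    (tendsto_pow_atTop two_ne_zero).comp tendsto_natCast_atTop_atTop
  have hcorr : Tendsto (fun n : ℕ => (potential μ τ Q S (coupled (α · ω) (δ · ω) (n ^ 2)).1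
      (coupled (α · ω) (δ · ω) (n ^ 2)).2 - max (coupled (α · ω) (δ · ω) (n ^ 2)).1
      (coupled (α · ω) (δ · ω) (n ^ 2)).2) / (n : ℝ) ^ 2) atTop (𝓝 0) := by
    refine squeeze_zero_norm (fun n => ?_) (hsq.const_div_atTop (|Q| + |S|))
    rw [Real.norm_eq_abs, abs_div, abs_of_nonneg (sq_nonneg (n : ℝ))]
    exact div_le_div_of_nonneg_right (abs_potential_sub_max_le hμ hτ Q S _ _) (sq_nonneg _)
  have h := (hlim.sub hcorr).add_const l
  rw [sub_zero, zero_add] at h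
  refine h.congr' ?_
  filter_upwards [eventually_ge_atTop 1] with n hn
  have hn' : (n : ℝ) ≠ 0 := by positivity
  push_cast
  field_simp
  ring

end Growth

end MaxPlus

theorem mainTheorem3 {Ω : Type*} [MeasurableSpace Ω] (P : Measure Ω) [IsProbabilityMeasure P]
    (μ τ : ℝ) (hμ : 0 < μ) (hτ : 0 < τ) (α δ : ℕ → Ω → ℝ)
    (hα : ∀ k, HasLaw (α k) (expMeasure μ) P)
    (hδ : ∀ k, HasLaw (δ k) (expMeasure τ) P)
    (hindep : iIndepFun (fun i : ℕ ⊕ ℕ => Sum.elim α δ i) P) :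
    MaxPlus.IsLyapunovExponent P (fun k ω => !![α k ω, 0; 0, δ k ω])
      ((μ ^ 4 + μ ^ 3 * τ + μ ^ 2 * τ ^ 2 + μ * τ ^ 3 + τ ^ 4) /
        (μ * τ * (μ + τ) * (μ ^ 2 + τ ^ 2))) ∧
    (μ = 1 → τ = 1 →
      MaxPlus.IsLyapunovExponent P (fun k ω => !![α k ω, 0; 0, δ k ω]) 1.25) := by
  have hmain : MaxPlus.IsLyapunovExponent P (fun k ω => !![α k ω, 0; 0, δ k ω])
      ((μ ^ 4 + μ ^ 3 * τ + μ ^ 2 * τ ^ 2 + μ * τ ^ 3 + τ ^ 4) /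
        (μ * τ * (μ + τ) * (μ ^ 2 + τ ^ 2))) := by
    have hs : μ + τ ≠ 0 := by positivity
    have hq : μ ^ 2 + τ ^ 2 ≠ 0 := by positivity
    set l := (μ ^ 4 + μ ^ 3 * τ + μ ^ 2 * τ ^ 2 + μ * τ ^ 3 + τ ^ 4) /
        (μ * τ * (μ + τ) * (μ ^ 2 + τ ^ 2)) with hl
    -- `Q` and `S` are solved from the first two balance equations in terms of `l`; the third then
    -- becomes a linear equation for `l`, satisfied by the stated fraction.
    have hlim := MaxPlus.ae_tendsto_max_coupled_div hμ hτ hα hδ hindep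
      (Q := (1 / μ - l) * (μ + τ) / μ) (S := (1 / τ - l) * (μ + τ) / τ) (l := l)
      (by field_simp; ring) (by field_simp; ring) (by rw [hl]; field_simp; ring)
    filter_upwards [hlim] with ω hω
    refine hω.congr fun n => ?_
    rw [one_div_mul_eq_div]
    rfl
  refine ⟨hmain, ?_⟩
  rintro rfl rfl
  convert hmain using 1
  norm_num
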